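/- Let $S$ and $A$ be finite sets (states and actions), $\bar P(s'\mid s,a)$ transition probabilities, $g_a(s)\in\mathbb{R}$ rewards, $\gamma\in(0,1]$ a discount factor and $\alpha>0$ a risk factor (an imaginary MDP). Assume that the MDP has a feasible plan: for some initial state $s_0$ there is a policy $\pi:S\to A$ such that, along the Markov chain $(s_l)$ started at $s_0$ and driven by $\pi$, the series $\mathcal{L}=\sum_{l\ge 0}\gamma^l g_{\pi(s_l)}(s_l)$ converges (absolutely) almost surely and $\mathbb{E}[\exp(\alpha\mathcal{L})]<\infty$. Let $\mathcal{Q}\subseteq\mathbb{R}^{S\times A}$ be any set of admissible $Q$-functions (for instance all of them), $c\in\mathbb{R}^{S\times A}$ a weight, and for every $(s,a)$ let $\Pi(s,a)$ be a set of policies $S\to A$ used to choose the next actions after $(s,a)$ (for instance one fixed policy, the policies chosen for data collection, or all policies). For $B\subseteq S\times A$ let $\mathrm{P}(B)$ be the program: maximize $\sum_{s,a}c(s,a)Q(s,a)$ over $Q\in\mathcal{Q}$ subject to $$Q(s,a)\le g_a(s)+\frac1\alpha\log\mathbb{E}_{s''\sim\bar P(\cdot\mid s,a)}\Big[\exp\Big(\alpha\gamma\sum_{s'\in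 S}\bar P(s'\mid s,a)\,Q(s',\pi(s'))\Big)\Big]\qquad\text{for all }(s,a)\in B,\ \pi\in\Pi(s,a).$$ Thus $\mathrm{P}(S\times A)$ is the full preview-based program. Let $\mu$ be a probability measure on $S\times A$, let $(s^1,a^1),\dots,(s^N,a^N)$ be drawn i.i.d. from $\mu$, and let the sampled program (Algorithm 1) be: maximize the same objective over $Q\in\mathcal{Q}$ subject to $$Q(s^i,a^i)\le g_{a^i}(s^i)+\frac1\alpha\log\Big(\frac1\iota\sum_{\kappa=1}^{\iota}\exp\Big(\alpha\gamma\sum_{s'\in S}\bar P(s'\mid s^i,a^i)\,Q(s',\pi(s'))\Big)\Big)\qquad\text{for all }i\le N,\ \pi\in\Pi(s^i,a^i),$$ where $\iota\ge1$ is an integer. Let $\epsilon,\bar\beta\in(0,1)$ and let $N_Q=|S\times A|$ be the number of state-action pairs. If $$N\ge\frac1\epsilon\Big(N_Q+\log\frac1{\bar\beta}\Big),$$ then with probability at least $1-\bar\beta$ there is a set $B\subseteq S\times A$ with $\mu(B)\ge1-\epsilon$ such that every $Q$ satisfying the constraints of the sampled program satisfies the constraints of $\mathrm{P}(B)$, and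 every solution (maximizer) of the sampled program is a feasible and optimal solution of $\mathrm{P}(B)$. -/

import Mathlib

open MeasureTheory ProbabilityTheory

noncomputable section

/-- The imaginary Markov decision process on a finite state space `S` (the cells of the grid) with
finite action set `A`: known transition probabilities `P s a`, previewed reward `g s a`
(written `g_a(s)`), and discount factor `γ ∈ (0, 1]`. -/
structure ImaginaryMDP (S A : Type*) where
  P : S → A → PMF S
  g : S → A → ℝ
  γ : ℝ
  γ_pos : 0 < γ
  γ_le_one : γ ≤ 1

namespace ImaginaryMDP

variable {S A : Type*}

section Plan

variable [Finite S] [MeasurableSpace S] [DiscreteMeasurableSpace S]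

/-- One step of the Markov chain induced by the policy `π`, as a kernel from histories
`(s₀, …, sₙ)` to the next state: only the current state `sₙ` matters. -/
def stepKernel (M : ImaginaryMDP S A) (π : S → A) (n : ℕ) :
    Kernel (Finset.Iic n → S) S :=
  (Kernel.ofFunOfCountable fun s : S => (M.P s (π s)).toMeasure).comap
    (fun h => h ⟨n, Finset.mem_Iic.2 le_rfl⟩) (measurable_pi_apply _)

instance (M : ImaginaryMDP S A) (π : S → A) (n : ℕ) : IsMarkovKernel (M.stepKernel π n) :=
  ⟨fun h => by
    change IsProbabilityMeasure
      (M.P (h ⟨n, Finset.mem_Iic.2 le_rfl⟩) (π (h ⟨n, Finset.mem_Iic.2 le_rfl⟩))).toMeasure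
    infer_instance⟩

/-- The law of the trajectory `(s₀, s₁, s₂, …)` started at `s₀` and following the policy `π`. -/
def pathLaw (M : ImaginaryMDP S A) (π : S → A) (s₀ : S) : Measure (ℕ → S) :=
  Kernel.traj (X := fun _ : ℕ => S) (M.stepKernel π) 0 (fun _ => s₀)

/-- The discounted cost `∑ₗ γˡ g_{π(sₗ)}(sₗ)` of a trajectory. -/
def pathCost (M : ImaginaryMDP S A) (π : S → A) (x : ℕ → S) : ℝ :=
  ∑' l : ℕ, M.γ ^ l * M.g (x l) (π (x l))

/-- `π` is a feasible plan from `s₀`: its entropic cost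
`(1/α) log E[exp (α ∑ₗ γˡ g_{π(sₗ)}(sₗ)) | s₀]` is well defined and finite, that is, the series
converges almost surely and its exponential has a finite expectation. -/
def IsFeasiblePlan (M : ImaginaryMDP S A) (α : ℝ) (s₀ : S) (π : S → A) : Prop :=
  (∀ᵐ x ∂(M.pathLaw π s₀), Summable fun l : ℕ => M.γ ^ l * M.g (x l) (π (x l))) ∧
    Integrable (fun x => Real.exp (α * M.pathCost π x)) (M.pathLaw π s₀)

end Plan

variable [Fintype S] [Fintype A]

/-- `∑_{s'} P(s' | s, a) Q(s', π(s'))`. -/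
def nextValue (M : ImaginaryMDP S A) (Q : S → A → ℝ) (s : S) (a : A) (π : S → A) : ℝ :=
  ∑ s', (M.P s a s').toReal * Q s' (π s')

/-- The risk-averse Bellman operator with continuation policy `π`:
`g_a(s) + (1/α) log E_{s'' ∼ P(· | s, a)} [exp (α γ ∑_{s'} P(s' | s, a) Q(s', π(s')))]`. -/
def bellman (M : ImaginaryMDP S A) (α : ℝ) (Q : S → A → ℝ) (s : S) (a : A) (π : S → A) : ℝ :=
  M.g s a + 1 / α *
    Real.log (∑ s'' : S, (M.P s a s'').toReal * Real.exp (α * M.γ * M.nextValue Q s a π))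

/-- The same with the expectation replaced by an average of `ι` terms. -/
def empiricalBellman (M : ImaginaryMDP S A) (α : ℝ) (ι : ℕ) (Q : S → A → ℝ) (s : S) (a : A)
    (π : S → A) : ℝ :=
  M.g s a + 1 / α *
    Real.log (1 / (ι : ℝ) * ∑ _κ ∈ Finset.range ι, Real.exp (α * M.γ * M.nextValue Q s a π))

/-- The objective `∑_{s,a} c(s,a) Q(s,a)` of the convex programs. -/
def objective (c Q : S → A → ℝ) : ℝ := ∑ s, ∑ a, c s a * Q s a

/-- Feasible set of the preview-based convex program with the Bellman inequalities imposed at the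
state-action pairs in `B` only (`B = Set.univ` is the full program). `𝒬` is the set of admissible
Q-functions and `pol s a` the set of policies by which the next actions after `(s, a)` are chosen. -/
def feasibleSet (M : ImaginaryMDP S A) (α : ℝ) (𝒬 : Set (S → A → ℝ))
    (pol : S → A → Set (S → A)) (B : Set (S × A)) : Set (S → A → ℝ) :=
  {Q | Q ∈ 𝒬 ∧ ∀ p ∈ B, ∀ π ∈ pol p.1 p.2, Q p.1 p.2 ≤ M.bellman α Q p.1 p.2 π}

/-- The database generated from the sampled state-action pairs `x 0, …, x (N - 1)`: each sampled
pair `(s, a)` is recorded together with the next-action rules `π ∈ pol s a`. -/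
def database {N : ℕ} (pol : S → A → Set (S → A)) (x : Fin N → S × A) : Set (S × A × (S → A)) :=
  {d | ∃ i, x i = (d.1, d.2.1) ∧ d.2.2 ∈ pol d.1 d.2.1}

/-- Feasible set of the sampled program: one empirical Bellman inequality for each entry of the
database. -/
def sampledFeasibleSet (M : ImaginaryMDP S A) (α : ℝ) (ι : ℕ) (𝒬 : Set (S → A → ℝ))
    (D : Set (S × A × (S → A))) : Set (S → A → ℝ) :=
  {Q | Q ∈ 𝒬 ∧ ∀ d ∈ D, Q d.1 d.2.1 ≤ M.empiricalBellman α ι Q d.1 d.2.1 d.2.2}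

/-- `Q` is a solution of the program that maximizes the objective over the feasible set `F`. -/
def IsSolution (c : S → A → ℝ) (F : Set (S → A → ℝ)) (Q : S → A → ℝ) : Prop :=
  Q ∈ F ∧ ∀ Q' ∈ F, objective c Q' ≤ objective c Q

end ImaginaryMDP

end

namespace ImaginaryMDP

variable {S A : Type*} [Fintype S]

/-! The exponent in the Bellman operator does not depend on `s''`, so the expectation and its
`ι`-term average agree: the sampled program is exactly the program restricted to the set `B` of
sampled pairs (`sampledFeasibleSet_database`). What remains is coverage: `B` must have mass at least
`1 - ε` with high probability. If it does not, the whole sample lies in some set of mass below `1 -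
ε`. Each such set traps the sample with probability at most `(1 - ε) ^ N`, and there are at most `2
^ |S × A|` of them, so a union bound suffices. -/

theorem sum_toReal_transition (M : ImaginaryMDP S A) (s : S) (a : A) :
    ∑ s', (M.P s a s').toReal = 1 := by
  rw [← ENNReal.toReal_sum fun s' _ => (M.P s a).apply_ne_top s', ← tsum_fintype (L := .unconditional S),
    PMF.tsum_coe, ENNReal.toReal_one]

/-- The integrand is constant in `s''` and the transition probabilities sum to one, so `log` cancels
`exp`. -/
theorem bellman_eq (M : ImaginaryMDP S A) (α : ℝ) (Q : S → A → ℝ) (s : S) (a : A)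
    (π : S → A) :
    M.bellman α Q s a π = M.g s a + 1 / α * (α * M.γ * M.nextValue Q s a π) := by
  rw [bellman, ← Finset.sum_mul, sum_toReal_transition, one_mul, Real.log_exp]

theorem empiricalBellman_eq_bellman (M : ImaginaryMDP S A) (α : ℝ) {ι : ℕ} (hι : 0 < ι)
    (Q : S → A → ℝ) (s : S) (a : A) (π : S → A) :
    M.empiricalBellman α ι Q s a π = M.bellman α Q s a π := by
  have hι' : (ι : ℝ) ≠ 0 := by positivity
  rw [bellman_eq, empiricalBellman, Finset.sum_const, Finset.card_range, nsmul_eq_mul,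
    ← mul_assoc, one_div_mul_cancel hι', one_mul, Real.log_exp]

/-- The sampled program is the preview-based program restricted to the sampled pairs. -/
theorem sampledFeasibleSet_database (M : ImaginaryMDP S A) (α : ℝ) {ι : ℕ} (hι : 0 < ι)
    (𝒬 : Set (S → A → ℝ)) (pol : S → A → Set (S → A)) {N : ℕ} (x : Fin N → S × A) :
    M.sampledFeasibleSet α ι 𝒬 (database pol x) = M.feasibleSet α 𝒬 pol (Set.range x) := by
  ext Q
  refine and_congr_right fun _ => ⟨?_, ?_⟩
  · rintro h _ ⟨i, rfl⟩ π hπ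
    rw [← M.empiricalBellman_eq_bellman α hι]
    exact h ((x i).1, (x i).2, π) ⟨i, rfl, hπ⟩
  · rintro h ⟨s, a, π⟩ ⟨i, hi, hπ⟩
    rw [M.empiricalBellman_eq_bellman α hι]
    exact h (s, a) ⟨i, hi⟩ π hπ

end ImaginaryMDP

section Coverage

variable {Ω E : Type*} [MeasurableSpace Ω] [MeasurableSpace E] {Pr : Measure Ω}
  {μ : Measure E} {N : ℕ} {X : Fin N → Ω → E}

theorem measureReal_forall_mem_eq_pow [IsProbabilityMeasure Pr] (hX : ∀ i, Measurable (X i))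
    (hlaw : ∀ i, Pr.map (X i) = μ) (hindep : iIndepFun X Pr) {T : Set E}
    (hT : MeasurableSet T) : Pr.real {ω | ∀ i, X i ω ∈ T} = μ.real T ^ N := by
  have h := hindep.measure_inter_preimage_eq_mul Finset.univ (sets := fun _ => T)
    fun _ _ => hT
  have hset : {ω | ∀ i, X i ω ∈ T} = ⋂ i ∈ Finset.univ, X i ⁻¹' T := by
    ext ω; simp
  have hi : ∀ i, Pr (X i ⁻¹' T) = μ T := fun i => by
    rw [← hlaw i, Measure.map_apply (hX i) hT]
  simp only [hi, Finset.prod_const, Finset.card_univ, Fintype.card_fin] at h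
  rw [hset, measureReal_def, h, ENNReal.toReal_pow, measureReal_def]

/-- Since `2 ≤ e` and `1 - ε ≤ exp (-ε)`, the left side is at most `exp (K - ε * N)`. This evaluates
the union bound over the subsets of a `K`-element set. -/
theorem two_pow_mul_one_sub_pow_le {K N : ℕ} {ε β : ℝ} (hε : ε ∈ Set.Ioo (0 : ℝ) 1)
    (hβ : 0 < β) (hN : 1 / ε * ((K : ℝ) + Real.log (1 / β)) ≤ N) :
    2 ^ K * (1 - ε) ^ N ≤ β := by
  have hN' : (K : ℝ) - Real.log β ≤ ε * N := by
    rw [one_div, one_div, Real.log_inv, inv_mul_le_iff₀ hε.1] at hN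
    linarith
  have h2 : (2 : ℝ) ^ K ≤ Real.exp K := by
    rw [← mul_one (K : ℝ), Real.exp_nat_mul]
    gcongr
    linarith [Real.add_one_le_exp (1 : ℝ)]
  have h1 : (1 - ε) ^ N ≤ Real.exp (-(ε * N)) := by
    rw [show -(ε * N) = N * -ε by ring, Real.exp_nat_mul]
    exact pow_le_pow_left₀ (by linarith [hε.2]) (Real.one_sub_le_exp_neg ε) N
  calc 2 ^ K * (1 - ε) ^ N ≤ Real.exp K * Real.exp (-(ε * N)) :=
        mul_le_mul h2 h1 (pow_nonneg (by linarith [hε.2]) N) (Real.exp_pos _).le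
    _ = Real.exp (K - ε * N) := by rw [← Real.exp_add, sub_eq_add_neg]
    _ ≤ Real.exp (Real.log β) := Real.exp_le_exp.2 (by linarith)
    _ = β := Real.exp_log hβ

/-- With probability at least `1 - β`, the values of an i.i.d. sample of size
`N ≥ (|E| + log (1/β)) / ε` carry at least `1 - ε` of the mass of the sampling distribution. -/
theorem one_sub_le_measureReal_range [Fintype E] [DiscreteMeasurableSpace E]
    [IsProbabilityMeasure Pr] (hX : ∀ i, Measurable (X i)) (hlaw : ∀ i, Pr.map (X i) = μ)
    (hindep : iIndepFun X Pr) {ε β : ℝ} (hε : ε ∈ Set.Ioo (0 : ℝ) 1) (hβ : 0 < β)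
    (hN : 1 / ε * ((Fintype.card E : ℝ) + Real.log (1 / β)) ≤ N) :
    1 - β ≤ Pr.real {ω | 1 - ε ≤ μ.real (Set.range fun i => X i ω)} := by
  classical
  -- The range of the sample is random, so the union bound runs over all fixed sets it could be when
  -- coverage fails.
  set light : Finset (Set E) := Finset.univ.filter fun T => μ.real T < 1 - ε with hlight
  set bad : Set Ω := ⋃ T ∈ light, {ω | ∀ i, X i ω ∈ T} with hbad
  have hmeas : MeasurableSet bad := by
    refine Finset.measurableSet_biUnion _ fun T _ => ?_
    rw [Set.ofPred_forall]
    exact MeasurableSet.iInter fun i => hX i T.toFinite.measurableSet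
  have hbound : Pr.real bad ≤ β := calc
    Pr.real bad ≤ ∑ T ∈ light, Pr.real {ω | ∀ i, X i ω ∈ T} :=
      measureReal_biUnion_finset_le _ _
    _ ≤ ∑ _T ∈ light, (1 - ε) ^ N := by
      refine Finset.sum_le_sum fun T hT => ?_
      rw [measureReal_forall_mem_eq_pow hX hlaw hindep T.toFinite.measurableSet]
      exact pow_le_pow_left₀ measureReal_nonneg (Finset.mem_filter.1 hT).2.le N
    _ = light.card * (1 - ε) ^ N := by rw [Finset.sum_const, nsmul_eq_mul]
    _ ≤ 2 ^ Fintype.card E * (1 - ε) ^ N := by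
      refine mul_le_mul_of_nonneg_right ?_ (pow_nonneg (by linarith [hε.2]) N)
      have : light.card ≤ 2 ^ Fintype.card E := by
        rw [← Fintype.card_set]; exact Finset.card_le_univ _
      exact_mod_cast this
    _ ≤ β := two_pow_mul_one_sub_pow_le hε hβ hN
  calc 1 - β ≤ 1 - Pr.real bad := by linarith
    _ = Pr.real badᶜ := (probReal_compl_eq_one_sub hmeas).symm
    -- If the range were light, it would itself be a light set containing the whole sample, putting
    -- `ω` in `bad`.
    _ ≤ _ := measureReal_mono fun ω hω => by
      by_contra hlt
      exact hω (Set.mem_biUnion (x := Set.range fun i => X i ω)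
        (Finset.mem_filter.2 ⟨Finset.mem_univ _, not_le.1 hlt⟩) fun i => ⟨i, rfl⟩)

end Coverage

theorem theorem2 {S A : Type*} [Fintype S] [Fintype A]
    [MeasurableSpace S] [DiscreteMeasurableSpace S]
    [MeasurableSpace A] [DiscreteMeasurableSpace A]
    (M : ImaginaryMDP S A) (α : ℝ) (hα : 0 < α) (s₀ : S)
    (hfeas : ∃ π : S → A, M.IsFeasiblePlan α s₀ π)
    (𝒬 : Set (S → A → ℝ)) (pol : S → A → Set (S → A)) (c : S → A → ℝ)
    (ι : ℕ) (hι : 0 < ι)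
    (ε β : ℝ) (hε : ε ∈ Set.Ioo (0 : ℝ) 1) (hβ : β ∈ Set.Ioo (0 : ℝ) 1)
    (μ : Measure (S × A)) [IsProbabilityMeasure μ]
    (N : ℕ) (hN : 1 / ε * ((Fintype.card (S × A) : ℝ) + Real.log (1 / β)) ≤ (N : ℝ))
    {Ω : Type*} [MeasurableSpace Ω] (Pr : Measure Ω) [IsProbabilityMeasure Pr]
    (X : Fin N → Ω → S × A) (hX : ∀ i, Measurable (X i))
    (hlaw : ∀ i, Pr.map (X i) = μ) (hindep : iIndepFun X Pr) :
    1 - β ≤ Pr.real {ω | ∃ B : Set (S × A), 1 - ε ≤ μ.real B ∧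
      M.sampledFeasibleSet α ι 𝒬 (ImaginaryMDP.database pol fun i => X i ω) ⊆
        M.feasibleSet α 𝒬 pol B ∧
      ∀ Q : S → A → ℝ,
        ImaginaryMDP.IsSolution c
          (M.sampledFeasibleSet α ι 𝒬 (ImaginaryMDP.database pol fun i => X i ω)) Q →
        ImaginaryMDP.IsSolution c (M.feasibleSet α 𝒬 pol B) Q} := by
  -- With `B` the set of sampled pairs, the two feasible sets coincide, and hence so do the
  -- maximizers.
  refine (one_sub_le_measureReal_range hX hlaw hindep hε hβ.1 hN).trans
    (measureReal_mono fun ω hω => ⟨Set.range fun i => X i ω, hω, ?_⟩)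
  rw [M.sampledFeasibleSet_database α hι]
  exact ⟨subset_rfl, fun _ hQ => hQ⟩
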